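/- A permutation of size $n\ge 0$ is a word $\pi=\pi(1)\pi(2)\cdots\pi(n)$ containing each of $1,\dots,n$ exactly once; $\varepsilon$ is the empty permutation. On words of distinct positive integers let $\mathbf S$ be the stack sorting operator, defined by $\mathbf S(\varepsilon)=\varepsilon$ and $\mathbf S(\alpha\, m\,\beta)=\mathbf S(\alpha)\,\mathbf S(\beta)\,m$, where $m$ is the largest letter of $\alpha m\beta$, and let $\mathbf R$ be the reversal operator, $\mathbf R(\pi(1)\cdots\pi(n))=\pi(n)\cdots\pi(1)$. A permutation $\theta$ of size $n$ is sorted by an operator $\mathbf B$ if $\mathbf B(\theta)=1\,2\cdots n$. For permutations $\alpha,\beta$ of sizes $a,b$ put $\alpha\oplus\beta=\alpha\,(\beta+a)$ and $\alpha\ominus\beta=(\alpha+b)\,\beta$, where $\beta+a$ is obtained from $\beta$ by adding $a$ to every letter. A permutation avoids $231$ if it has no (not necessarily consecutive) subword $b\,c\,a$ with $a<b<c$; every non-empty such permutation is uniquely of the form $\alpha\oplus(1\ominus\beta)$ with $\alpha,\beta$ avoiding $231$. Define $P$ on $231$-avoiding permutations recursively by $P(\varepsilon)=\varepsilon$ and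 $P(\alpha\oplus(1\ominus\beta))=(P(\alpha)\oplus 1)\ominus P(\beta)$, and let $\lambda_\pi$ be the permutation with $P(\pi)=\lambda_\pi\circ\pi$. Corollary. Let $\mathbf A$ be any composition of finitely many (possibly zero) operators from $\{\mathbf S,\mathbf R\}$. For every permutation $\theta$ sorted by $\mathbf S\circ\mathbf A$, the permutation $\mathbf A(\theta)$ avoids $231$, so that $\Phi_{\mathbf A}(\theta)=\lambda_{\mathbf A(\theta)}\circ\theta$ is defined; and $\Phi_{\mathbf A}$ is a size-preserving bijection from the set of permutations (of all sizes) sorted by $\mathbf S\circ\mathbf A$ onto the set of permutations sorted by $\mathbf S\circ\mathbf R\circ\mathbf A$. -/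

import Mathlib

namespace StackSorting

/-- A permutation of `[n] = {1, …, n}` in one-line notation, i.e. the word `π(1) π(2) … π(n)`;
the size `n` is the length of the word. -/
def IsPermutation (w : List ℕ) : Prop :=
  w.Perm (List.range' 1 w.length)

/-- The increasing permutation `1 2 … n`. -/
def identityPerm (n : ℕ) : List ℕ := List.range' 1 n

/-- The largest letter of a word (`0` for the empty word). -/
def maxLetter (w : List ℕ) : ℕ := w.foldr max 0

/-- The part `α` of a word `α n β` whose largest letter is `n`. -/
def beforeMax (w : List ℕ) : List ℕ := w.take (w.idxOf (maxLetter w))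

/-- The part `β` of a word `α n β` whose largest letter is `n`. -/
def afterMax (w : List ℕ) : List ℕ := w.drop (w.idxOf (maxLetter w) + 1)

theorem maxLetter_mem {w : List ℕ} (h : w ≠ []) : maxLetter w ∈ w := by
  induction w with
  | nil => exact absurd rfl h
  | cons a l ih =>
    by_cases hl : l = []
    · subst hl
      simp [maxLetter]
    · have h1 := ih hl
      have h2 : maxLetter (a :: l) = max a (maxLetter l) := rfl
      rw [h2]
      rcases max_choice a (maxLetter l) with h3 | h3 <;> rw [h3] <;> simp [h1]

theorem maxLetter_le {w : List ℕ} {m : ℕ} (h : ∀ x ∈ w, x ≤ m) : maxLetter w ≤ m := by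
  by_cases hw : w = []
  · subst hw
    simp [maxLetter]
  · exact h _ (maxLetter_mem hw)

theorem le_maxLetter {w : List ℕ} {x : ℕ} (h : x ∈ w) : x ≤ maxLetter w := by
  induction w with
  | nil => simp at h
  | cons a l ih =>
    have h2 : maxLetter (a :: l) = max a (maxLetter l) := rfl
    rw [h2]
    rcases List.mem_cons.1 h with rfl | h
    · exact le_max_left _ _
    · exact (ih h).trans (le_max_right _ _)

theorem length_beforeMax_lt {w : List ℕ} (h : w ≠ []) : (beforeMax w).length < w.length := by
  have h1 := List.idxOf_lt_length_of_mem (maxLetter_mem h)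
  simp only [beforeMax, List.length_take]
  omega

theorem length_afterMax_lt {w : List ℕ} (h : w ≠ []) : (afterMax w).length < w.length := by
  have h1 := List.length_pos_of_ne_nil h
  simp only [afterMax, List.length_drop]
  omega

theorem split_max {α β : List ℕ} {n : ℕ} (hα : ∀ x ∈ α, x < n) (hβ : ∀ x ∈ β, x < n) :
    maxLetter (α ++ n :: β) = n ∧ beforeMax (α ++ n :: β) = α ∧ afterMax (α ++ n :: β) = β := by
  have hm : maxLetter (α ++ n :: β) = n := by
    refine le_antisymm (maxLetter_le ?_) (le_maxLetter (by simp))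
    intro x hx
    rcases List.mem_append.1 hx with hx | hx
    · exact (hα x hx).le
    · rcases List.mem_cons.1 hx with rfl | hx
      · exact le_rfl
      · exact (hβ x hx).le
  have hn : n ∉ α := fun h => lt_irrefl _ (hα n h)
  have hi : (α ++ n :: β).idxOf n = α.length := by
    rw [List.idxOf_append_of_notMem hn]
    simp
  refine ⟨hm, ?_, ?_⟩
  · simp [beforeMax, hm, hi]
  · simp [afterMax, hm, hi]

/-- The stack sorting operator: `S(ε) = ε` and `S(α n β) = S(α) S(β) n`, where `n` is the largest
letter. -/
def stackSort (w : List ℕ) : List ℕ :=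
  if h : w = [] then []
  else stackSort (beforeMax w) ++ stackSort (afterMax w) ++ [maxLetter w]
termination_by w.length
decreasing_by
  · exact length_beforeMax_lt h
  · exact length_afterMax_lt h

theorem stackSort_nil : stackSort [] = [] := by
  rw [stackSort]
  simp

theorem stackSort_split {α β : List ℕ} {n : ℕ} (hα : ∀ x ∈ α, x < n) (hβ : ∀ x ∈ β, x < n) :
    stackSort (α ++ n :: β) = stackSort α ++ stackSort β ++ [n] := by
  obtain ⟨h1, h2, h3⟩ := split_max hα hβ
  rw [stackSort, dif_neg (by simp), h1, h2, h3]

/-- The reversal operator `R`, reading a word from right to left. -/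
def reversal (w : List ℕ) : List ℕ := w.reverse

/-- The operators obtained by composing `S` and `R` as many times as desired (possibly zero). -/
inductive IsComposition : (List ℕ → List ℕ) → Prop
  | id : IsComposition id
  | comp_stackSort {A : List ℕ → List ℕ} : IsComposition A → IsComposition (A ∘ stackSort)
  | comp_reversal {A : List ℕ → List ℕ} : IsComposition A → IsComposition (A ∘ reversal)

/-- The set of all permutations (of all sizes) that the operator `B` sends to an increasing
permutation `1 2 … n`. -/
def sortedBy (B : List ℕ → List ℕ) : Set (List ℕ) :=
  {θ | IsPermutation θ ∧ B θ = identityPerm θ.length}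

/-- Avoidance of the pattern `231`: there is no subword (not necessarily consecutive) `b c a` with
`a < b < c`. -/
def Avoids231 (w : List ℕ) : Prop :=
  ∀ a b c : ℕ, a < b → b < c → ¬ [b, c, a].Sublist w

/-- The sum `α ⊕ β = α (β + |α|)`. -/
def directSum (α β : List ℕ) : List ℕ := α ++ β.map (· + α.length)

/-- The skew sum `α ⊖ β = (α + |β|) β`. -/
def skewSum (α β : List ℕ) : List ℕ := α.map (· + β.length) ++ β

/-- The map `P` on `231`-avoiding permutations, given by `P(ε) = ε` and
`P(α ⊕ (1 ⊖ β)) = (P(α) ⊕ 1) ⊖ P(β)` (see `bijP_sum`). In `π = α ⊕ (1 ⊖ β)` the word `α` is what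
precedes the largest letter, and `β` is what follows it, with every letter lowered by `|α|`.
The values at other words play no role. -/
def bijP (w : List ℕ) : List ℕ :=
  if h : w = [] then []
  else
    skewSum (directSum (bijP (beforeMax w)) [1])
      (bijP ((afterMax w).map (· - (beforeMax w).length)))
termination_by w.length
decreasing_by
  · exact length_beforeMax_lt h
  · simpa using length_afterMax_lt h

theorem bijP_nil : bijP [] = [] := by
  rw [bijP]
  simp

theorem IsPermutation.le_length {w : List ℕ} (h : IsPermutation w) {x : ℕ} (hx : x ∈ w) :
    x ≤ w.length := by
  have := (List.Perm.mem_iff h).1 hx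
  rw [List.mem_range'_1] at this
  omega

theorem bijP_sum {α β : List ℕ} (hα : IsPermutation α) (hβ : IsPermutation β) :
    bijP (directSum α (skewSum [1] β)) = skewSum (directSum (bijP α) [1]) (bijP β) := by
  have e : directSum α (skewSum [1] β)
      = α ++ (1 + β.length + α.length) :: β.map (· + α.length) := by
    simp [directSum, skewSum]
  obtain ⟨-, h2, h3⟩ := split_max (α := α) (β := β.map (· + α.length))
    (n := 1 + β.length + α.length)
    (fun x hx => by have := hα.le_length hx; omega)
    (fun x hx => by
      obtain ⟨y, hy, rfl⟩ := List.mem_map.1 hx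
      have := hβ.le_length hy
      omega)
  rw [e, bijP, dif_neg (by simp), h2, h3]
  simp [Function.comp_def]

theorem length_bijP (w : List ℕ) : (bijP w).length = w.length := by
  induction hn : w.length using Nat.strong_induction_on generalizing w with
  | _ n ih =>
    subst hn
    by_cases h : w = []
    · subst h
      simp [bijP_nil]
    · have h1 := length_beforeMax_lt h
      have h2 := length_afterMax_lt h
      have h3 := List.idxOf_lt_length_of_mem (maxLetter_mem h)
      rw [bijP, dif_neg h]
      simp only [skewSum, directSum, List.length_append, List.length_map,
        List.length_singleton]
      rw [ih _ h1 _ rfl, ih _ h2 _ (by simp)]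
      simp only [beforeMax, afterMax, List.length_take, List.length_drop]
      omega

/-- The relabelling `λ_π`, determined on the values `1, …, n` of a permutation `π` by
`P(π) = λ_π ∘ π` (see `map_relabel`): the value `v = π(i)` is sent to `P(π)(i)`. -/
def relabel (π : List ℕ) (v : ℕ) : ℕ := (bijP π).getD (π.idxOf v) 0

theorem map_relabel {π : List ℕ} (h : IsPermutation π) : π.map (relabel π) = bijP π := by
  have hnd : π.Nodup := (List.Perm.nodup_iff h).2 List.nodup_range'
  apply List.ext_getElem
  · simp [length_bijP]
  · intro i h1 h2
    have h3 : i < π.length := by simpa using h1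
    simp [relabel, hnd.idxOf_getElem i h3, h2]

/-- `Φ_A(θ) = λ_{A(θ)} ∘ θ`. -/
def Phi (A : List ℕ → List ℕ) (θ : List ℕ) : List ℕ := θ.map (relabel (A θ))

end StackSorting

namespace StackSorting

/-! Call two letters separated if a larger letter stands between them. Neither `stackSort` nor
`reversal` creates separated pairs, so a pair separated in `A θ` is separated in every intermediate
word. Stack sorting does not depend on the relative order of separated letters (`stackSort_map`);
hence a relabelling that reorders only pairs separated in `A θ` commutes with `A`
(`IsComposition.map`).

A permutation `θ` lies in the source iff `A θ = word 0 t` for a binary tree `t`, and in the target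
iff `A θ = coword 0 t` for some `t`; `bijP` takes the first word to the second. The two words of `t`
order a pair of places differently only if the pair is separated in both (`pairs_compare`), so both
`relabel` and its inverse commute with `A`. -/

/-! ### Splitting at the largest letter; the operators only rearrange letters. -/

theorem eq_beforeMax_append {w : List ℕ} (h : w ≠ []) :
    w = beforeMax w ++ maxLetter w :: afterMax w := by
  have h1 := List.idxOf_lt_length_of_mem (maxLetter_mem h)
  have h2 : w[w.idxOf (maxLetter w)] = maxLetter w := List.getElem_idxOf h1
  conv_lhs => rw [← List.take_append_drop (w.idxOf (maxLetter w)) w,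
    List.drop_eq_getElem_cons h1, h2]
  rfl

/-- Induction on a word with distinct letters by splitting it at its largest letter. -/
theorem nodup_induction {p : ∀ w : List ℕ, w.Nodup → Prop} (nil : p [] List.nodup_nil)
    (split : ∀ α n β (h : (α ++ n :: β).Nodup) (ha : α.Nodup) (hb : β.Nodup),
      (∀ x ∈ α, x < n) → (∀ x ∈ β, x < n) → p α ha → p β hb → p (α ++ n :: β) h)
    (w : List ℕ) (hw : w.Nodup) : p w hw := by
  induction hn : w.length using Nat.strong_induction_on generalizing w with
  | _ n ih =>
    subst hn
    by_cases h : w = []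
    · subst h
      exact nil
    · have e := eq_beforeMax_append h
      have hle : ∀ x ∈ w, x ≤ maxLetter w := fun x hx => le_maxLetter hx
      have h1 := ih _ (length_beforeMax_lt h) (beforeMax w)
      have h2 := ih _ (length_afterMax_lt h) (afterMax w)
      generalize beforeMax w = α at *
      generalize afterMax w = β at *
      generalize maxLetter w = m at *
      subst e
      have hw' := hw
      rw [List.nodup_append, List.nodup_cons] at hw'
      obtain ⟨ha, ⟨hmβ, hb⟩, hd⟩ := hw'
      refine split α m β hw ha hb (fun x hx => ?_) (fun x hx => ?_) (h1 ha rfl) (h2 hb rfl)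
      · exact lt_of_le_of_ne (hle x (by simp [hx])) (hd x hx m (by simp))
      · exact lt_of_le_of_ne (hle x (by simp [hx])) (fun e => hmβ (e ▸ hx))

theorem stackSort_perm (w : List ℕ) : (stackSort w).Perm w := by
  induction hn : w.length using Nat.strong_induction_on generalizing w with
  | _ n ih =>
    subst hn
    by_cases h : w = []
    · subst h
      simp [stackSort_nil]
    · rw [stackSort, dif_neg h]
      conv_rhs => rw [eq_beforeMax_append h]
      have h1 := ih _ (length_beforeMax_lt h) _ rfl
      have h2 := ih _ (length_afterMax_lt h) _ rfl
      rw [List.append_assoc]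
      exact h1.append ((List.perm_append_singleton _ _).trans (h2.cons _))

theorem IsComposition.perm {A : List ℕ → List ℕ} (hA : IsComposition A) (w : List ℕ) :
    (A w).Perm w := by
  induction hA generalizing w with
  | id => exact List.Perm.refl _
  | comp_stackSort _ ih => exact (ih _).trans (stackSort_perm w)
  | comp_reversal _ ih => exact (ih _).trans w.reverse_perm

theorem IsPermutation.nodup {w : List ℕ} (h : IsPermutation w) : w.Nodup :=
  (List.Perm.nodup_iff h).2 List.nodup_range'

theorem IsPermutation.of_perm {v w : List ℕ} (h : IsPermutation w) (e : v.Perm w) :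
    IsPermutation v := by
  unfold IsPermutation
  rw [e.length_eq]
  exact e.trans h

/-! ### Separated pairs and their pullback along compositions. -/

/-- The letters `a` and `b` of `w` are separated by a letter larger than both. -/
def Separated (w : List ℕ) (a b : ℕ) : Prop :=
  ∃ c, a < c ∧ b < c ∧ ([a, c, b].Sublist w ∨ [b, c, a].Sublist w)

theorem Separated.symm {w : List ℕ} {a b : ℕ} (h : Separated w a b) : Separated w b a := by
  obtain ⟨c, h1, h2, h3⟩ := h
  exact ⟨c, h2, h1, h3.symm⟩

theorem Separated.mono {v w : List ℕ} {a b : ℕ} (h : Separated v a b) (hvw : v.Sublist w) :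
    Separated w a b := by
  obtain ⟨c, h1, h2, h3⟩ := h
  exact ⟨c, h1, h2, h3.imp (fun h => h.trans hvw) (fun h => h.trans hvw)⟩

theorem separated_append_cons {α β : List ℕ} {a b n : ℕ} (ha : a ∈ α) (hb : b ∈ β)
    (han : a < n) (hbn : b < n) : Separated (α ++ n :: β) a b := by
  refine ⟨n, han, hbn, Or.inl ?_⟩
  exact (List.singleton_sublist.2 ha).append ((List.singleton_sublist.2 hb).cons_cons n)

theorem Separated.of_reverse {w : List ℕ} {a b : ℕ} (h : Separated w.reverse a b) :
    Separated w a b := by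
  obtain ⟨c, h1, h2, h3⟩ := h
  refine ⟨c, h1, h2, h3.symm.imp (fun h => ?_) (fun h => ?_)⟩ <;> simpa using h.reverse

theorem triple_sublist_append {u v : List ℕ} {x y z : ℕ} (h : [x, y, z].Sublist (u ++ v)) :
    [x, y, z].Sublist u ∨ [x, y, z].Sublist v ∨ (x ∈ u ∧ z ∈ v) := by
  obtain ⟨l₁, l₂, e, h1, h2⟩ := List.sublist_append_iff.1 h
  rcases l₁ with _ | ⟨x', l₁⟩
  · right; left; simpa [e] using h2
  · obtain ⟨rfl, e'⟩ := List.cons_eq_cons.1 e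
    by_cases hl : l₂ = []
    · left; subst hl; simpa [e] using h1
    · right; right
      refine ⟨h1.subset (by simp), h2.subset ?_⟩
      -- Both parts of the subword are non-empty here, so its last letter `z` comes from `v`.
      have hz : [x, y, z].getLast? = (x :: l₁ ++ l₂).getLast? := by rw [← e]
      rw [List.getLast?_append_of_ne_nil _ hl] at hz
      exact List.mem_of_getLast? hz.symm

/-- In `S(α) S(β) n` the letter `n` is last and separates nothing. A pair inside one block is
handled by induction, and a pair across the two blocks is separated by `n` in `α n β`. -/
theorem Separated.of_stackSort {w : List ℕ} (hw : w.Nodup) {a b : ℕ}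
    (h : Separated (stackSort w) a b) : Separated w a b := by
  induction w, hw using nodup_induction with
  | nil => rwa [stackSort_nil] at h
  | split α n β _ _ _ hα hβ ih1 ih2 =>
    have key : ∀ x c y, x < c → y < c → [x, c, y].Sublist (stackSort (α ++ n :: β)) →
        Separated (stackSort α) x y ∨ Separated (stackSort β) x y ∨
          Separated (α ++ n :: β) x y := by
      intro x c y hx hy hs
      rw [stackSort_split hα hβ] at hs
      have hle : ∀ z ∈ stackSort α ++ stackSort β ++ [n], z ≤ n := by
        intro z hz
        simp only [List.mem_append, List.mem_singleton, (stackSort_perm _).mem_iff] at hz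
        rcases hz with (hz | hz) | hz
        · exact (hα z hz).le
        · exact (hβ z hz).le
        · exact hz.le
      have hc : c ≤ n := hle c (hs.subset (by simp))
      rcases triple_sublist_append hs with hs | hs | ⟨-, hs⟩
      · rcases triple_sublist_append hs with hs | hs | ⟨h1, h2⟩
        · exact Or.inl ⟨c, hx, hy, Or.inl hs⟩
        · exact Or.inr (Or.inl ⟨c, hx, hy, Or.inl hs⟩)
        · rw [(stackSort_perm _).mem_iff] at h1 h2
          exact Or.inr (Or.inr (separated_append_cons h1 h2 (hα x h1) (hβ y h2)))
      · simpa using hs.length_le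
      -- The last letter of the triple would be `n`, yet smaller than `c ≤ n`.
      · rw [List.mem_singleton] at hs
        omega
    have fin : Separated (stackSort α) a b ∨ Separated (stackSort β) a b ∨
        Separated (α ++ n :: β) a b := by
      obtain ⟨c, h1, h2, h3 | h3⟩ := h
      · exact key a c b h1 h2 h3
      · exact (key b c a h2 h1 h3).imp Separated.symm (Or.imp Separated.symm Separated.symm)
    rcases fin with h | h | h
    · exact (ih1 h).mono (List.sublist_append_left _ _)
    · exact (ih2 h).mono ((List.sublist_cons_self _ _).trans (List.sublist_append_right _ _))
    · exact h

theorem IsComposition.separated {A : List ℕ → List ℕ} (hA : IsComposition A) {w : List ℕ}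
    (hw : w.Nodup) {a b : ℕ} (h : Separated (A w) a b) : Separated w a b := by
  induction hA generalizing w with
  | id => exact h
  | comp_stackSort _ ih =>
    exact (ih ((stackSort_perm w).nodup_iff.2 hw) h).of_stackSort hw
  | comp_reversal _ ih => exact (ih (List.nodup_reverse.2 hw) h).of_reverse

/-! ### Relabellings that commute with compositions. -/

/-- `f` preserves the order of any two letters of `w` that are not separated by a larger one. -/
def Respects (f : ℕ → ℕ) (w : List ℕ) : Prop :=
  ∀ a ∈ w, ∀ b ∈ w, a < b → f a < f b ∨ Separated w a b

/-- A letter between two letters of the prefix `u` is in `u` itself; distinctness keeps `a` and `b`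
from recurring in `v`. -/
theorem Separated.of_append_left {u v : List ℕ} (h : (u ++ v).Nodup) {a b : ℕ} (ha : a ∈ u)
    (hb : b ∈ u) (hs : Separated (u ++ v) a b) : Separated u a b := by
  have hd := List.disjoint_of_nodup_append h
  obtain ⟨c, h1, h2, h3⟩ := hs
  refine ⟨c, h1, h2, h3.imp (fun h => ?_) (fun h => ?_)⟩
  · rcases triple_sublist_append h with h | h | ⟨-, h⟩
    · exact h
    · exact (hd ha (h.subset (by simp))).elim
    · exact (hd hb h).elim
  · rcases triple_sublist_append h with h | h | ⟨-, h⟩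
    · exact h
    · exact (hd ha (h.subset (by simp))).elim
    · exact (hd ha h).elim

theorem Separated.of_append_right {u v : List ℕ} (h : (u ++ v).Nodup) {a b : ℕ} (ha : a ∈ v)
    (hb : b ∈ v) (hs : Separated (u ++ v) a b) : Separated v a b := by
  have hs' : Separated (u ++ v).reverse a b := Separated.of_reverse (by simpa using hs)
  rw [List.reverse_append] at hs'
  refine (hs'.of_append_left ?_ (by simpa using ha) (by simpa using hb)).of_reverse
  rw [← List.reverse_append]
  exact List.nodup_reverse.2 h

/-- Nothing exceeds `n`, so nothing is separated from it: its image is still the largest, the word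
splits at the same place, and induction applies to both sides. -/
theorem stackSort_map {w : List ℕ} (hw : w.Nodup) {f : ℕ → ℕ} (hf : Respects f w) :
    stackSort (w.map f) = (stackSort w).map f := by
  induction w, hw using nodup_induction with
  | nil => simp [stackSort_nil]
  | split α n β hnd _ _ hα hβ ih1 ih2 =>
    have hle : ∀ z ∈ α ++ n :: β, z ≤ n := by
      intro z hz
      simp only [List.mem_append, List.mem_cons] at hz
      rcases hz with hz | hz | hz
      · exact (hα z hz).le
      · exact hz.le
      · exact (hβ z hz).le
    have hlt : ∀ x ∈ α ++ n :: β, x < n → f x < f n := by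
      intro x hx hxn
      refine (hf x hx n (by simp) hxn).resolve_right ?_
      rintro ⟨c, -, h2, h3⟩
      have : c ∈ α ++ n :: β := by
        rcases h3 with h3 | h3 <;> exact h3.subset (by simp)
      exact absurd (hle c this) (not_le.2 h2)
    have hβ' : Respects f β := by
      intro a ha b hb hab
      refine (hf a (by simp [ha]) b (by simp [hb]) hab).imp_right fun h => ?_
      rw [List.append_cons] at h hnd
      exact h.of_append_right hnd ha hb
    have hα' : Respects f α := fun a ha b hb hab =>
      (hf a (by simp [ha]) b (by simp [hb]) hab).imp_right fun h => h.of_append_left hnd ha hb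
    rw [List.map_append, List.map_cons, stackSort_split, stackSort_split hα hβ, ih1 hα', ih2 hβ']
    · simp
    · intro y hy
      obtain ⟨x, hx, rfl⟩ := List.mem_map.1 hy
      exact hlt x (by simp [hx]) (hα x hx)
    · intro y hy
      obtain ⟨x, hx, rfl⟩ := List.mem_map.1 hy
      exact hlt x (by simp [hx]) (hβ x hx)

theorem IsComposition.map {A : List ℕ → List ℕ} (hA : IsComposition A) {w : List ℕ}
    (hw : w.Nodup) {f : ℕ → ℕ} (hf : Respects f (A w)) : A (w.map f) = (A w).map f := by
  induction hA generalizing w with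
  | id => rfl
  | @comp_stackSort A hA ih =>
    have hnd : (stackSort w).Nodup := (stackSort_perm w).nodup_iff.2 hw
    -- Separations in the final word pull back to `w`, so the condition on the output also holds at
    -- the input.
    have hw' : Respects f w := fun a ha b hb hab =>
      (hf a ((hA.perm _).mem_iff.2 ((stackSort_perm w).mem_iff.2 ha)) b
        ((hA.perm _).mem_iff.2 ((stackSort_perm w).mem_iff.2 hb)) hab).imp_right
        fun h => (hA.separated hnd h).of_stackSort hw
    simp only [Function.comp_apply, stackSort_map hw hw']
    exact ih hnd hf
  | comp_reversal _ ih =>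
    have := ih (List.nodup_reverse.2 hw) hf
    simpa [reversal] using this

/-! ### Binary trees and their two words. -/

/-- Binary trees, the shapes of the decompositions `α ⊕ (1 ⊖ β)`. -/
inductive Shape
  | leaf : Shape
  | node : Shape → Shape → Shape

namespace Shape

/-- The number of nodes. -/
def size : Shape → ℕ
  | leaf => 0
  | node l r => l.size + r.size + 1

/-- The mirror image. -/
def mirror : Shape → Shape
  | leaf => leaf
  | node l r => node r.mirror l.mirror

/-- The `231`-avoiding word on the letters `s + 1, …, s + t.size` with decomposition tree `t`. -/
def word (s : ℕ) : Shape → List ℕ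
  | leaf => []
  | node l r => word s l ++ (s + l.size + r.size + 1) :: word (s + l.size) r

/-- The `132`-avoiding word on the letters `s + 1, …, s + t.size` with decomposition tree `t`. -/
def coword (s : ℕ) : Shape → List ℕ
  | leaf => []
  | node l r => coword (s + r.size) l ++ (s + l.size + r.size + 1) :: coword s r

/-- The letters of `word s t` paired with the letters of `coword s' t` at the same places. -/
def pairs (s s' : ℕ) : Shape → List (ℕ × ℕ)
  | leaf => []
  | node l r => pairs s (s' + r.size) l ++
      (s + l.size + r.size + 1, s' + l.size + r.size + 1) :: pairs (s + l.size) s' r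

theorem mirror_mirror (t : Shape) : t.mirror.mirror = t := by
  induction t with
  | leaf => rfl
  | node l r h1 h2 => simp [mirror, h1, h2]

theorem size_mirror (t : Shape) : t.mirror.size = t.size := by
  induction t with
  | leaf => rfl
  | node l r h1 h2 => simp [mirror, size, h1, h2, add_comm]

/-- Transfers facts about `word` to `coword`, and accounts for the extra `reversal` in the target.
-/
theorem reverse_word_mirror (s : ℕ) (t : Shape) : (word s t.mirror).reverse = coword s t := by
  induction t generalizing s with
  | leaf => rfl
  | node l r h1 h2 =>
    simp [mirror, word, coword, h1, h2, size_mirror, Nat.add_right_comm]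

theorem reverse_coword (s : ℕ) (t : Shape) : (coword s t).reverse = word s t.mirror := by
  rw [← reverse_word_mirror, List.reverse_reverse]

theorem length_word (s : ℕ) (t : Shape) : (word s t).length = t.size := by
  induction t generalizing s with
  | leaf => rfl
  | node l r h1 h2 => simp [word, size, h1, h2, add_assoc]

theorem length_coword (s : ℕ) (t : Shape) : (coword s t).length = t.size := by
  rw [← List.length_reverse, reverse_coword, length_word, size_mirror]

theorem mem_word {s x : ℕ} {t : Shape} (h : x ∈ word s t) : s < x ∧ x ≤ s + t.size := by
  induction t generalizing s with
  | leaf => simp [word] at h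
  | node l r h1 h2 =>
    simp only [word, List.mem_append, List.mem_cons] at h
    simp only [size]
    rcases h with h | h | h
    · have := h1 h; omega
    · omega
    · have := h2 h; omega

theorem mem_coword {s x : ℕ} {t : Shape} (h : x ∈ coword s t) : s < x ∧ x ≤ s + t.size := by
  rw [← List.mem_reverse, reverse_coword] at h
  simpa [size_mirror] using mem_word h

theorem split_word (s : ℕ) (l r : Shape) :
    (∀ x ∈ word s l, x < s + l.size + r.size + 1) ∧
      ∀ x ∈ word (s + l.size) r, x < s + l.size + r.size + 1 :=
  ⟨fun x hx => by have := mem_word hx; omega, fun x hx => by have := mem_word hx; omega⟩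

theorem stackSort_word (s : ℕ) (t : Shape) :
    stackSort (word s t) = List.range' (s + 1) t.size := by
  induction t generalizing s with
  | leaf => simp [word, stackSort_nil, size]
  | node l r h1 h2 =>
    rw [word, stackSort_split (split_word s l r).1 (split_word s l r).2, h1, h2, size,
      List.range'_concat, ← List.range'_append_1]
    simp [Nat.add_right_comm, ← add_assoc]

/-- Since `S` preserves length, cutting the interval after `|α|` letters shows that `α` and `β` sort
to consecutive intervals, each of which yields a subtree. -/
theorem exists_word_of_stackSort {w : List ℕ} (hw : w.Nodup) {s : ℕ}
    (h : stackSort w = List.range' (s + 1) w.length) : ∃ t, w = word s t := by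
  induction w, hw using nodup_induction generalizing s with
  | nil => exact ⟨leaf, rfl⟩
  | split α n β _ _ _ hα hβ h1 h2 =>
    rw [stackSort_split hα hβ, List.length_append, List.length_cons, ← add_assoc,
      List.range'_concat, ← List.range'_append_1] at h
    obtain ⟨h, hn⟩ := List.append_inj' h rfl
    obtain ⟨ha, hb⟩ := List.append_inj h (by simp [(stackSort_perm α).length_eq])
    obtain ⟨l, rfl⟩ := h1 ha
    rw [Nat.add_right_comm] at hb
    obtain ⟨r, rfl⟩ := h2 hb
    refine ⟨node l r, ?_⟩
    simp only [List.cons.injEq, and_true] at hn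
    simp only [length_word] at hn
    rw [word, hn, length_word]
    congr 2
    omega

theorem word_injective (s : ℕ) : Function.Injective (word s) := by
  intro t t' h
  induction t generalizing s t' with
  | leaf => cases t' <;> simp_all [word]
  | node l r h1 h2 =>
    cases t' with
    | leaf => simp [word] at h
    | node l' r' =>
      obtain ⟨-, a, b⟩ := split_max (split_word s l r).1 (split_word s l r).2
      obtain ⟨-, a', b'⟩ := split_max (split_word s l' r').1 (split_word s l' r').2
      rw [word, word] at h
      rw [h] at a b
      obtain rfl := h1 s (a.symm.trans a')
      obtain rfl := h2 _ (b.symm.trans b')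
      rfl

theorem coword_injective (s : ℕ) : Function.Injective (coword s) := by
  intro t t' h
  have := congrArg List.reverse h
  rw [reverse_coword, reverse_coword] at this
  rw [← mirror_mirror t, word_injective s this, mirror_mirror]

theorem word_add (s k : ℕ) (t : Shape) : word (s + k) t = (word s t).map (· + k) := by
  induction t generalizing s with
  | leaf => rfl
  | node l r h1 h2 =>
    rw [word, word, h1, Nat.add_right_comm s k l.size, h2]
    simp
    omega

theorem coword_add (s k : ℕ) (t : Shape) : coword (s + k) t = (coword s t).map (· + k) := by
  rw [← reverse_word_mirror, word_add, ← List.map_reverse, reverse_word_mirror]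

theorem bijP_word (t : Shape) : bijP (word 0 t) = coword 0 t := by
  induction t with
  | leaf => simp [word, coword, bijP_nil]
  | node l r h1 h2 =>
    obtain ⟨-, a, b⟩ := split_max (split_word 0 l r).1 (split_word 0 l r).2
    rw [word, bijP, dif_neg (by simp), a, b, h1, length_word, word_add, List.map_map]
    have : ((· - l.size) ∘ (· + l.size) : ℕ → ℕ) = id := by
      ext; simp
    rw [this, List.map_id, h2, coword, coword_add]
    simp [skewSum, directSum, length_coword]
    omega

theorem avoids231_word (s : ℕ) (t : Shape) : Avoids231 (word s t) := by
  induction t generalizing s with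
  | leaf => intro a b c _ _ h; simp [word] at h
  | node l r h1 h2 =>
    intro a b c hab hbc h
    have hle : ∀ x ∈ word (s + l.size) r, _ := (split_word s l r).2
    rw [word] at h
    rcases triple_sublist_append h with h | h | ⟨h3, h4⟩
    · exact h1 _ a b c hab hbc h
    · rw [List.cons_sublist_cons'] at h
      rcases h with h | ⟨rfl, h⟩
      · exact h2 _ a b c hab hbc h
      · have := hle c (List.Sublist.subset ‹_› (by simp : c ∈ [c, a]))
        omega
    · have := mem_word h3
      rw [List.mem_cons] at h4
      rcases h4 with h4 | h4
      · omega
      · have := mem_word h4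
        omega

theorem map_fst_pairs (s s' : ℕ) (t : Shape) : (pairs s s' t).map Prod.fst = word s t := by
  induction t generalizing s s' with
  | leaf => rfl
  | node l r h1 h2 => simp [pairs, word, h1, h2]

theorem map_snd_pairs (s s' : ℕ) (t : Shape) : (pairs s s' t).map Prod.snd = coword s' t := by
  induction t generalizing s s' with
  | leaf => rfl
  | node l r h1 h2 => simp [pairs, coword, h1, h2]

theorem fst_mem_word {s s' : ℕ} {t : Shape} {p : ℕ × ℕ} (h : p ∈ pairs s s' t) :
    p.1 ∈ word s t :=
  map_fst_pairs s s' t ▸ List.mem_map_of_mem h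

theorem snd_mem_coword {s s' : ℕ} {t : Shape} {p : ℕ × ℕ} (h : p ∈ pairs s s' t) :
    p.2 ∈ coword s' t :=
  map_snd_pairs s s' t ▸ List.mem_map_of_mem h

/-- Two places of a tree either compare in the same way in the two words, or are separated by a
larger letter in both. -/
theorem pairs_compare (s s' : ℕ) (t : Shape) {p q : ℕ × ℕ} (hp : p ∈ pairs s s' t)
    (hq : q ∈ pairs s s' t) :
    (p.1 < q.1 ↔ p.2 < q.2) ∨
      (Separated (word s t) p.1 q.1 ∧ Separated (coword s' t) p.2 q.2) := by
  induction t generalizing s s' with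
  | leaf => simp [pairs] at hp
  | node l r h1 h2 =>
    have hl : ∀ p ∈ pairs s (s' + r.size) l, (s < p.1 ∧ p.1 ≤ s + l.size) ∧
        (s' + r.size < p.2 ∧ p.2 ≤ s' + r.size + l.size) :=
      fun p hp => ⟨mem_word (fst_mem_word hp), mem_coword (snd_mem_coword hp)⟩
    have hr : ∀ p ∈ pairs (s + l.size) s' r, (s + l.size < p.1 ∧ p.1 ≤ s + l.size + r.size) ∧
        (s' < p.2 ∧ p.2 ≤ s' + r.size) :=
      fun p hp => ⟨mem_word (fst_mem_word hp), mem_coword (snd_mem_coword hp)⟩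
    have hlr : ∀ p ∈ pairs s (s' + r.size) l, ∀ q ∈ pairs (s + l.size) s' r,
        Separated (word s (node l r)) p.1 q.1 ∧ Separated (coword s' (node l r)) p.2 q.2 := by
      intro p hp q hq
      have := hl p hp
      have := hr q hq
      exact ⟨separated_append_cons (fst_mem_word hp) (fst_mem_word hq) (by omega) (by omega),
        separated_append_cons (snd_mem_coword hp) (snd_mem_coword hq) (by omega) (by omega)⟩
    rw [pairs, List.mem_append, List.mem_cons] at hp hq
    -- Places in the same subtree go by induction, places in different subtrees are separated by the
    -- root, and the root carries the largest letter of both words.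
    rcases hp with hp | rfl | hp <;> rcases hq with hq | rfl | hq
    · refine (h1 _ _ hp hq).imp_right (And.imp ?_ ?_) <;>
        exact fun h => h.mono (List.sublist_append_left _ _)
    · have := hl p hp
      left; dsimp only; omega
    · exact Or.inr (hlr p hp q hq)
    · have := hl q hq
      left; dsimp only; omega
    · left; simp
    · have := hr q hq
      left; dsimp only; omega
    · exact Or.inr ((hlr q hq p hp).imp Separated.symm Separated.symm)
    · have := hr p hp
      left; dsimp only; omega
    · refine (h2 _ _ hp hq).imp_right (And.imp ?_ ?_) <;>
        exact fun h => h.mono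
          ((List.sublist_cons_self _ _).trans (List.sublist_append_right _ _))

theorem respects_of_map_word {t : Shape} {f : ℕ → ℕ} {s s' : ℕ}
    (h : (word s t).map f = coword s' t) : Respects f (word s t) := by
  rw [← map_fst_pairs s s' t, ← map_snd_pairs s s' t, List.map_map, List.map_inj_left] at h
  intro a ha b hb hab
  rw [← map_fst_pairs s s' t, List.mem_map] at ha hb
  obtain ⟨p, hp, rfl⟩ := ha
  obtain ⟨q, hq, rfl⟩ := hb
  have h1 : f p.1 = p.2 := h p hp
  have h2 : f q.1 = q.2 := h q hq
  rw [h1, h2]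
  exact (pairs_compare s s' t hp hq).imp (fun h => h.1 hab) And.left

theorem respects_of_map_coword {t : Shape} {f : ℕ → ℕ} {s s' : ℕ}
    (h : (coword s' t).map f = word s t) : Respects f (coword s' t) := by
  rw [← map_fst_pairs s s' t, ← map_snd_pairs s s' t, List.map_map, List.map_inj_left] at h
  intro a ha b hb hab
  rw [← map_snd_pairs s s' t, List.mem_map] at ha hb
  obtain ⟨p, hp, rfl⟩ := ha
  obtain ⟨q, hq, rfl⟩ := hb
  have h1 : f p.2 = p.1 := h p hp
  have h2 : f q.2 = q.1 := h q hq
  rw [h1, h2]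
  exact (pairs_compare s s' t hp hq).imp (fun h => h.2 hab) And.right

theorem isPermutation_word (t : Shape) : IsPermutation (word 0 t) := by
  have h := (stackSort_perm (word 0 t)).symm
  rw [stackSort_word] at h
  unfold IsPermutation
  rwa [length_word]

theorem isPermutation_coword (t : Shape) : IsPermutation (coword 0 t) :=
  (isPermutation_word t.mirror).of_perm
    (reverse_word_mirror 0 t ▸ List.reverse_perm _)

end Shape

/-! ### The two sorted sets in terms of trees, and the action of `Phi`. -/

open Shape

theorem mem_sortedBy_stackSort_comp {A : List ℕ → List ℕ} (hA : IsComposition A) {θ : List ℕ} :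
    θ ∈ sortedBy (stackSort ∘ A) ↔ ∃ t, A θ = word 0 t := by
  constructor
  · rintro ⟨h1, h2⟩
    refine exists_word_of_stackSort (h1.of_perm (hA.perm θ)).nodup ?_
    rw [(hA.perm θ).length_eq]
    exact h2
  · rintro ⟨t, ht⟩
    refine ⟨(isPermutation_word t).of_perm (ht ▸ (hA.perm θ).symm), ?_⟩
    rw [Function.comp_apply, ht, stackSort_word, ← (hA.perm θ).length_eq, ht, length_word]
    rfl

theorem mem_sortedBy_stackSort_reversal_comp {A : List ℕ → List ℕ} (hA : IsComposition A)
    {θ : List ℕ} :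
    θ ∈ sortedBy (stackSort ∘ reversal ∘ A) ↔ ∃ t, A θ = coword 0 t := by
  have hp : (A θ).reverse.Perm θ := (List.reverse_perm _).trans (hA.perm θ)
  constructor
  · rintro ⟨h1, h2⟩
    obtain ⟨t, ht⟩ := exists_word_of_stackSort (s := 0) (h1.of_perm hp).nodup
      (by rw [hp.length_eq]; exact h2)
    refine ⟨t.mirror, ?_⟩
    rw [← reverse_word_mirror, mirror_mirror, ← ht, List.reverse_reverse]
  · rintro ⟨t, ht⟩
    refine ⟨(isPermutation_coword t).of_perm (ht ▸ (hA.perm θ).symm), ?_⟩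
    rw [Function.comp_apply, Function.comp_apply, reversal, ht, reverse_coword, stackSort_word,
      ← (hA.perm θ).length_eq, ht, length_coword, size_mirror]
    rfl

theorem map_relabel_word (t : Shape) : (word 0 t).map (relabel (word 0 t)) = coword 0 t := by
  rw [map_relabel (isPermutation_word t), bijP_word]

theorem IsComposition.apply_Phi {A : List ℕ → List ℕ} (hA : IsComposition A) {θ : List ℕ}
    {t : Shape} (h : A θ = word 0 t) : A (Phi A θ) = coword 0 t := by
  have hθ : θ.Nodup := (hA.perm θ).nodup_iff.1 (h ▸ (isPermutation_word t).nodup)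
  rw [Phi, h, hA.map hθ, h, map_relabel_word]
  exact h ▸ respects_of_map_word (map_relabel_word t)

/-- Supplies the inverse relabelling, from `coword 0 t` back to `word 0 t`; the default `0` is never
read on letters of `u`. -/
theorem exists_map_eq {u v : List ℕ} (hu : u.Nodup) (h : u.length = v.length) :
    ∃ f : ℕ → ℕ, u.map f = v := by
  refine ⟨fun x => v.getD (u.idxOf x) 0, List.ext_getElem (by simpa using h) ?_⟩
  intro i h1 h2
  have h3 : i < u.length := by simpa using h1
  simp [hu.idxOf_getElem i h3, h2]

theorem map_map_cancel {u v θ : List ℕ} {f g : ℕ → ℕ} (hθ : θ.Perm u) (hf : u.map f = v)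
    (hg : v.map g = u) : (θ.map f).map g = θ := by
  rw [← hf, List.map_map] at hg
  have h : u.map (g ∘ f) = u.map id := by rw [List.map_id, hg]
  rw [List.map_map]
  conv_rhs => rw [← List.map_id θ]
  exact List.map_congr_left fun x hx => List.map_inj_left.1 h x (hθ.mem_iff.1 hx)

end StackSorting

open StackSorting StackSorting.Shape in
theorem mainTheorem3 (A : List ℕ → List ℕ) (hA : StackSorting.IsComposition A) :
    (∀ θ ∈ StackSorting.sortedBy (StackSorting.stackSort ∘ A),
      StackSorting.IsPermutation (A θ) ∧ StackSorting.Avoids231 (A θ)) ∧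
    Set.BijOn (StackSorting.Phi A)
      (StackSorting.sortedBy (StackSorting.stackSort ∘ A))
      (StackSorting.sortedBy (StackSorting.stackSort ∘ StackSorting.reversal ∘ A)) ∧
    (∀ θ ∈ StackSorting.sortedBy (StackSorting.stackSort ∘ A),
      (StackSorting.Phi A θ).length = θ.length) := by
  refine ⟨fun θ hθ => ?_, ⟨fun θ hθ => ?_, fun θ₁ h₁ θ₂ h₂ e => ?_, fun θ hθ => ?_⟩,
    fun θ _ => by simp [Phi]⟩
  · obtain ⟨t, ht⟩ := (mem_sortedBy_stackSort_comp hA).1 hθ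
    rw [ht]
    exact ⟨isPermutation_word t, avoids231_word 0 t⟩
  · obtain ⟨t, ht⟩ := (mem_sortedBy_stackSort_comp hA).1 hθ
    exact (mem_sortedBy_stackSort_reversal_comp hA).2 ⟨t, hA.apply_Phi ht⟩
  · obtain ⟨t, ht⟩ := (mem_sortedBy_stackSort_comp hA).1 h₁
    obtain ⟨t', ht'⟩ := (mem_sortedBy_stackSort_comp hA).1 h₂
    have e' := congrArg A e
    rw [hA.apply_Phi ht, hA.apply_Phi ht'] at e'
    -- Equal images force the same tree, hence the same relabelling, and one inverse `f` recovers
    -- both permutations.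
    obtain rfl := coword_injective 0 e'
    rw [Phi, Phi, ht, ht'] at e
    obtain ⟨f, hf⟩ := exists_map_eq (isPermutation_coword t).nodup
      (v := word 0 t) (by rw [length_word, length_coword])
    have c₁ := map_map_cancel (ht ▸ (hA.perm θ₁).symm) (map_relabel_word t) hf
    have c₂ := map_map_cancel (ht' ▸ (hA.perm θ₂).symm) (map_relabel_word t) hf
    rw [← c₁, e, c₂]
  · obtain ⟨t, ht⟩ := (mem_sortedBy_stackSort_reversal_comp hA).1 hθ
    obtain ⟨f, hf⟩ := exists_map_eq (isPermutation_coword t).nodup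
      (v := word 0 t) (by rw [length_word, length_coword])
    -- The preimage is `θ` relabelled by the inverse `f`, which commutes with `A` for the same
    -- reason as `relabel`.
    have hA' : A (θ.map f) = word 0 t := by
      rw [hA.map hθ.1.nodup (ht ▸ respects_of_map_coword hf), ht, hf]
    refine ⟨θ.map f, (mem_sortedBy_stackSort_comp hA).2 ⟨t, hA'⟩, ?_⟩
    rw [Phi, hA', map_map_cancel (ht ▸ (hA.perm θ).symm) hf (map_relabel_word t)]
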